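/- **Proposition (All analytic $P$-ideals are good).** *Definitions.* An ideal on a countably infinite set $S$ is a family of subsets of $S$ that is closed under subsets and finite unions, contains all finite subsets of $S$ and does not contain $S$. Let $\mathcal J$ be an ideal on $\omega$; write $\mathcal J^+=\mathcal P(\omega)\setminus\mathcal J$ for the family of $\mathcal J$-positive sets and $\mathcal J|_X=\{A\subseteq X: A\in\mathcal J\}$ for $X\in\mathcal J^+$. - $\mathcal J$ is *analytic* if it is an analytic subset of the Cantor space $2^\omega$; it is a *$P$-ideal* if for all $A_0,A_1,\ldots\in\mathcal J$ there is $B\in\mathcal J$ such that $A_n\setminus B$ is finite for every $n$. - $\mathcal J$ is *good* if every uncountable family $\mathcal F\subseteq\mathcal J^+$ has a countably infinite subfamily $\{B_n:n\in\omega\}$ (the $B_n$ pairwise distinct) such that for every $f\in\omega^\omega$ there are sets $C_n\in\mathcal J$ with $C_n\subseteq B_n\setminus\{0,\ldots,f(n)-1\}$ and $\bigcup_n C_n\in\mathcal J^+$. - $\mathfrak b$ is the least cardinality of a family $\mathcal F\subseteq\omega^\omega$ for which there is no $g\in\omega^\omega$ such that for every $f\in\mathcal F$, $f(n)\le g(n)$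 for all but finitely many $n$. - For $X\in\mathcal J^+$, $\mathrm{cov}^+(\mathcal J|_X)$ is the least cardinality of a family $\mathcal F\subseteq\mathcal J|_X$ such that every $Y\subseteq X$ with $Y\in\mathcal J^+$ has an infinite intersection with some $F\in\mathcal F$ (and $\infty$ if there is no such family), and $\mathrm{cov}^+_h(\mathcal J)=\min\{\mathrm{cov}^+(\mathcal J|_X):X\in\mathcal J^+\}$. - $\mathfrak a(\mathcal J)$ is the least cardinality of an uncountable family $\mathcal A\subseteq\mathcal J^+$ that is maximal with respect to the property that the intersection of any two distinct members of $\mathcal A$ is in $\mathcal J$ (and $\infty$ if there is no such family). - $\mathcal Z=\{A\subseteq\omega:\lim_{n\to\infty}|A\cap\{0,\ldots,n-1\}|/n=0\}$. The ideal $\mathrm{tr}(\mathcal N)$ on $2^{<\omega}$ consists of those $A\subseteq 2^{<\omega}$ for which $\{x\in2^\omega: x|_n\in A\text{ for infinitely many }n\}$ is null in the standard product measure on $2^\omega$. It is regarded as an ideal on $\omega$ by means of an arbitrary bijection between $2^{<\omega}$ and $\omega$. *Statement.* Every analytic $P$-ideal $\mathcal J$ on $\omega$ is good, and satisfies $$\min\{\mathfrak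 b,\mathrm{cov}^+_h(\mathcal J)\}\le\mathfrak a(\mathcal J).$$ In particular, $\mathcal Z$ and $\mathrm{tr}(\mathcal N)$ (the latter transported to $\omega$ along any bijection) are analytic $P$-ideals; hence they are good and satisfy this inequality. -/

import Mathlib

open Set Filter Topology MeasureTheory
open scoped Cardinal

namespace AntichainNumbers

/-- `𝒥` is an ideal on the set `α`: a family of subsets of `α` closed under subsets and finite
unions, which contains all finite sets and does not contain `α` itself. -/
structure IsIdealOn {α : Type} (𝒥 : Set (Set α)) : Prop where
  isIdeal : Order.IsIdeal 𝒥
  finite_mem : ∀ s : Set α, s.Finite → s ∈ 𝒥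
  univ_notMem : (Set.univ : Set α) ∉ 𝒥

/-- The family `𝒥⁺` of `𝒥`-positive sets. -/
def positive {α : Type} (𝒥 : Set (Set α)) : Set (Set α) := {X | X ∉ 𝒥}

/-- `𝒥` is a `P`-ideal: every sequence of members of `𝒥` has a pseudo-union in `𝒥`, that is,
some `B ∈ 𝒥` with `A n ⊆* B` (inclusion up to a finite set) for all `n`. -/
def IsPIdeal {α : Type} (𝒥 : Set (Set α)) : Prop :=
  ∀ A : ℕ → Set α, (∀ n, A n ∈ 𝒥) → ∃ B ∈ 𝒥, ∀ n, (A n \ B).Finite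

/-- A family of subsets of `ω` is analytic if the set of characteristic functions of its members
is an analytic subset of the Cantor space `2^ω`. -/
def IsAnalyticFamily (𝒥 : Set (Set ℕ)) : Prop :=
  AnalyticSet {x : ℕ → Bool | {n | x n = true} ∈ 𝒥}

/-- `𝒥` is an analytic `P`-ideal on `ω`. -/
structure IsAnalyticPIdeal (𝒥 : Set (Set ℕ)) : Prop where
  isIdealOn : IsIdealOn 𝒥
  isAnalytic : IsAnalyticFamily 𝒥
  isPIdeal : IsPIdeal 𝒥

/-- `𝒥` is good: every uncountable family `ℱ` of positive sets has a countably infinite subfamily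
`{B n : n ∈ ω}` (enumerated without repetitions) such that for every `f ∈ ω^ω` there are
`C n ∈ 𝒥` with `C n ⊆ B n \ f(n)`, where `f(n) = {0, …, f(n) - 1}`, whose union is positive. -/
def IsGood (𝒥 : Set (Set ℕ)) : Prop :=
  ∀ ℱ : Set (Set ℕ), ℱ ⊆ positive 𝒥 → ¬ ℱ.Countable →
    ∃ B : ℕ → Set ℕ, Function.Injective B ∧ (∀ n, B n ∈ ℱ) ∧
      ∀ f : ℕ → ℕ, ∃ C : ℕ → Set ℕ,
        (∀ n, C n ∈ 𝒥) ∧ (∀ n, C n ⊆ B n \ Set.Iio (f n)) ∧ (⋃ n, C n) ∈ positive 𝒥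

/-- The bounding number `𝔟`: the least cardinality of a family of functions `ω → ω` that is not
dominated by a single function. -/
noncomputable def bounding : Cardinal.{0} :=
  sInf {κ | ∃ ℱ : Set (ℕ → ℕ), (¬ ∃ g : ℕ → ℕ, ∀ f ∈ ℱ, f ≤ᶠ[atTop] g) ∧ #ℱ = κ}

/-- The restriction `𝒥|X`, a family of subsets of `X`. -/
def restrict {α : Type} (𝒥 : Set (Set α)) (X : Set α) : Set (Set X) :=
  {A | (Subtype.val '' A : Set α) ∈ 𝒥}

/-- `cov⁺(𝒥)`: the least size of a family `ℱ ⊆ 𝒥` such that every positive set has an infinite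
intersection with some member of `ℱ`. The value is `⊤` if there is no such family. -/
noncomputable def covPlus {α : Type} (𝒥 : Set (Set α)) : WithTop Cardinal.{0} :=
  ⨅ (ℱ : Set (Set α)) (_ : ℱ ⊆ 𝒥 ∧ ∀ X ∈ positive 𝒥, ∃ F ∈ ℱ, (X ∩ F).Infinite),
    ((#ℱ : Cardinal.{0}) : WithTop Cardinal.{0})

/-- `cov⁺_h(𝒥)`: the minimum of `cov⁺(𝒥|X)` over the positive sets `X`. -/
noncomputable def covPlusH {α : Type} (𝒥 : Set (Set α)) : WithTop Cardinal.{0} :=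
  ⨅ X ∈ positive 𝒥, covPlus (restrict 𝒥 X)

/-- `𝒜` is a family of positive sets, any two (distinct) members of which have their
intersection in `𝒥`. -/
def IsAntichainMod {α : Type} (𝒥 : Set (Set α)) (𝒜 : Set (Set α)) : Prop :=
  𝒜 ⊆ positive 𝒥 ∧ 𝒜.Pairwise fun A B => A ∩ B ∈ 𝒥

/-- The antichain number `𝔞(𝒥)`: the least size of an uncountable maximal antichain modulo `𝒥`.
The value is `⊤` if there is no such antichain. -/
noncomputable def antichainNumber {α : Type} (𝒥 : Set (Set α)) : WithTop Cardinal.{0} :=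
  ⨅ (𝒜 : Set (Set α)) (_ : Maximal (IsAntichainMod 𝒥) 𝒜 ∧ ¬ 𝒜.Countable),
    ((#𝒜 : Cardinal.{0}) : WithTop Cardinal.{0})

/-- The density zero ideal `𝒵` on `ω`. -/
def densityZero : Set (Set ℕ) :=
  {A | Tendsto (fun n : ℕ => ((A ∩ Set.Iio n).ncard : ℝ) / (n : ℝ)) atTop (𝓝 0)}

/-- The standard product (fair coin) measure on the Cantor space `2^ω`. -/
noncomputable def cantorMeasure : Measure (ℕ → Bool) :=
  Measure.infinitePi fun _ : ℕ => (PMF.uniformOfFintype Bool).toMeasure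

/-- For `A ⊆ 2^{<ω}`, the set `G(A)` of all `x ∈ 2^ω` with `x|n ∈ A` for infinitely many `n`. -/
def limitSet (A : Set (List Bool)) : Set (ℕ → Bool) :=
  {x | ∃ᶠ n : ℕ in atTop, List.ofFn (fun i : Fin n => x i) ∈ A}

/-- The trace of the null ideal, `tr(𝒩)`, a family of subsets of `2^{<ω}`. -/
def traceNull : Set (Set (List Bool)) :=
  {A | cantorMeasure (limitSet A) = 0}

/-- The copy on `ω` of a family of subsets of `α`, along a bijection `e : α ≃ ω`. -/
def copy {α : Type} (e : α ≃ ℕ) (𝒥 : Set (Set α)) : Set (Set ℕ) :=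
  {A | e ⁻¹' A ∈ 𝒥}

end AntichainNumbers

/-!
The heart of the matter is a description of an analytic `P`-ideal `𝒥` by finite sets
(`IsAnalyticPIdeal.exists_finset_families`): there are countably many families `K i` of finite
sets such that `X ∈ 𝒥` if and only if, for each `i`, all finite subsets of some final segment of
`X` are in `K i`. It takes the place of Solecki's representation by lower semicontinuous
submeasures. To obtain it, parametrize `𝒥` continuously by the Baire space, `z ↦ g z`. Since `𝒥`
is `σ`-directed modulo finite sets, removing the countably many basic open sets whose image is not
cofinal in `(𝒥, ⊆*)` leaves a closed set `P`, each nonempty relatively open part of which has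
cofinal image. For a basic open set `U` that meets `P`, let `K U` consist of the finite sets
covered by `g z` for some `z ∈ P ∩ U`. Cofinality gives one implication. For the other, `X` is
covered, block of integers by block, along two sequences converging in `P`. The block that one
sequence covers can be prolonged up to any point, so it can be made to reach the point from which
the other sequence can go on. The two limits `α` and `β` satisfy `X ⊆* g α ∪ g β`.

Goodness (`IsAnalyticPIdeal.isGood`) follows: a positive set violates the condition for some `i`,
so uncountably many members of an uncountable family do so for the same `i`, and the finite sets
witnessing this can be taken arbitrarily far out in each member.

For the inequality, even `𝔟 ≤ 𝔞(𝒥)` holds (`IsGood.bounding_le_mk`): if an uncountable antichain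
had fewer than `𝔟` members, goodness applied to a dominating function would yield a positive set
whose intersection with every member is in `𝒥`.

The ideals `𝒵` and `tr(𝒩)` are Borel, the latter by Fubini's theorem, and pseudo-unions are
obtained by removing long enough initial parts.
-/

namespace AntichainNumbers

/-! ### Ideals -/

section Ideals

variable {α : Type} {𝒥 : Set (Set α)}

theorem IsIdealOn.mem_of_subset (h : IsIdealOn 𝒥) {A B : Set α} (hB : B ∈ 𝒥) (hAB : A ⊆ B) :
    A ∈ 𝒥 :=
  h.isIdeal.IsLowerSet hAB hB

theorem IsIdealOn.union_mem (h : IsIdealOn 𝒥) {A B : Set α} (hA : A ∈ 𝒥) (hB : B ∈ 𝒥) :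
    A ∪ B ∈ 𝒥 := by
  obtain ⟨C, hC, hAC, hBC⟩ := h.isIdeal.Directed A hA B hB
  exact h.mem_of_subset hC (union_subset hAC hBC)

theorem IsIdealOn.biUnion_lt_mem (h : IsIdealOn 𝒥) {A : ℕ → Set α} (hA : ∀ n, A n ∈ 𝒥) (N : ℕ) :
    (⋃ n < N, A n) ∈ 𝒥 := by
  induction N with
  | zero => simpa using h.finite_mem ∅ finite_empty
  | succ N ih =>
    refine h.mem_of_subset (h.union_mem ih (hA N)) ?_
    intro x hx
    simp only [mem_iUnion, mem_union, exists_prop] at hx ⊢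
    obtain ⟨n, hn, hx⟩ := hx
    rcases Nat.lt_succ_iff_lt_or_eq.mp hn with h | rfl
    · exact Or.inl ⟨n, h, hx⟩
    · exact Or.inr hx

theorem IsIdealOn.of_union_mem (hmono : ∀ A B : Set α, A ⊆ B → B ∈ 𝒥 → A ∈ 𝒥)
    (hunion : ∀ A B : Set α, A ∈ 𝒥 → B ∈ 𝒥 → A ∪ B ∈ 𝒥)
    (hfin : ∀ A : Set α, A.Finite → A ∈ 𝒥) (huniv : (univ : Set α) ∉ 𝒥) : IsIdealOn 𝒥 where
  isIdeal :=
    { IsLowerSet := fun B A hAB hB => hmono A B hAB hB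
      Nonempty := ⟨∅, hfin ∅ finite_empty⟩
      Directed := fun A hA B hB => ⟨A ∪ B, hunion A B hA hB, subset_union_left,
        subset_union_right⟩ }
  finite_mem := hfin
  univ_notMem := huniv

theorem IsPIdeal.exists_pseudounion (h : IsPIdeal 𝒥) {ι : Type*} [Countable ι] [Nonempty ι]
    (A : ι → Set α) (hA : ∀ i, A i ∈ 𝒥) : ∃ B ∈ 𝒥, ∀ i, (A i \ B).Finite := by
  obtain ⟨e, he⟩ := exists_surjective_nat ι
  obtain ⟨B, hB, hfin⟩ := h (A ∘ e) fun n => hA (e n)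
  refine ⟨B, hB, fun i => ?_⟩
  obtain ⟨n, rfl⟩ := he i
  exact hfin n

end Ideals

/-! ### The structure of analytic `P`-ideals -/

theorem exists_cylinder_subset {U : Set (ℕ → ℕ)} (hU : IsOpen U) {y : ℕ → ℕ} (hy : y ∈ U) :
    ∃ n, PiNat.cylinder y n ⊆ U := by
  obtain ⟨_, ⟨x, n, rfl⟩, hyx, hsub⟩ :=
    (PiNat.isTopologicalBasis_cylinders (fun _ : ℕ => ℕ)).exists_subset_of_mem_open hy hU
  exact ⟨n, by rwa [PiNat.mem_cylinder_iff_eq.mp hyx]⟩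

/-- Points of a closed set `P` of the Baire space, the `k`-th of which agrees with its successor
below `n k`, converge to a point of `P`. -/
theorem exists_mem_forall_mem_cylinder {P : Set (ℕ → ℕ)} (hP : IsClosed P) {y : ℕ → ℕ → ℕ}
    (hy : ∀ k, y k ∈ P) {n : ℕ → ℕ} (hn : StrictMono n)
    (hstep : ∀ k, y (k + 1) ∈ PiNat.cylinder (y k) (n k)) :
    ∃ a ∈ P, ∀ k, a ∈ PiNat.cylinder (y k) (n k) := by
  have hagree : ∀ k l, k ≤ l → ∀ i < n k, y l i = y k i := by
    intro k l hkl
    induction l, hkl using Nat.le_induction with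
    | base => exact fun _ _ => rfl
    | succ l hkl ih =>
      exact fun i hi => (hstep l i (hi.trans_le (hn.monotone hkl))).trans (ih i hi)
  have ha : ∀ k, (fun i => y (i + 1) i) ∈ PiNat.cylinder (y k) (n k) := by
    intro k i hi
    have hi' : i < n (i + 1) := (Nat.lt_succ_self i).trans_le hn.le_apply
    rcases le_total k (i + 1) with h | h
    · exact hagree k (i + 1) h i hi
    · exact (hagree (i + 1) k h i hi').symm
  refine ⟨_, ?_, ha⟩
  by_contra hmem
  obtain ⟨k, hk⟩ := exists_cylinder_subset hP.isOpen_compl hmem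
  refine hk (fun i hi => ?_) (hy k)
  exact ((ha k) i (hi.trans_le hn.le_apply)).symm

/-- An analytic `P`-ideal is the set of all `X` such that, for each of countably many families
`K i` of finite sets, all finite subsets of some final segment of `X` are in `K i`. -/
theorem IsAnalyticPIdeal.exists_finset_families {𝒥 : Set (Set ℕ)} (h : IsAnalyticPIdeal 𝒥) :
    ∃ (ι : Type) (_ : Countable ι) (K : ι → Set (Finset ℕ)),
      ∀ X, X ∈ 𝒥 ↔ ∀ i, ∃ m, ∀ a : Finset ℕ, (a : Set ℕ) ⊆ X \ Iio m → a ∈ K i := by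
  classical
  have hI := h.isIdealOn
  -- A continuous parametrization `g` of the ideal by the Baire space.
  obtain ⟨g, hg𝒥, hsurj, hcont⟩ : ∃ g : (ℕ → ℕ) → Set ℕ, (∀ z, g z ∈ 𝒥) ∧
      (∀ X ∈ 𝒥, ∃ z, g z = X) ∧ ∀ a : Finset ℕ, IsOpen {z | (a : Set ℕ) ⊆ g z} := by
    have han := h.isAnalytic
    rw [IsAnalyticFamily, AnalyticSet] at han
    rcases han with hempty | ⟨p, hp, hrange⟩
    · have : (fun _ => false : ℕ → Bool) ∈ {x : ℕ → Bool | {n | x n = true} ∈ 𝒥} := by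
        simpa using hI.finite_mem ∅ finite_empty
      rw [hempty] at this
      exact this.elim
    · refine ⟨fun z => {n | p z n = true}, fun z => ?_, fun X hX => ?_, fun a => ?_⟩
      · have : p z ∈ range p := mem_range_self z
        rwa [hrange] at this
      · have : (fun n => decide (n ∈ X)) ∈ range p := by
          rw [hrange]
          simpa using hX
        obtain ⟨z, hz⟩ := this
        exact ⟨z, by ext n; simp [hz]⟩
      · have : {z | (a : Set ℕ) ⊆ {n | p z n = true}} = ⋂ n ∈ a, {z | p z n = true} := by
          ext z
          simp [subset_def]
        rw [this]
        refine isOpen_biInter_finset fun n _ => ?_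
        exact (isOpen_discrete {true}).preimage ((continuous_apply n).comp hp)
  let Cofinal : Set (ℕ → ℕ) → Prop := fun U => ∀ X ∈ 𝒥, ∃ z ∈ U, (X \ g z).Finite
  let b := TopologicalSpace.countableBasis (ℕ → ℕ)
  have hb : TopologicalSpace.IsTopologicalBasis b :=
    TopologicalSpace.isBasis_countableBasis (ℕ → ℕ)
  have : Countable b := (TopologicalSpace.countable_countableBasis (ℕ → ℕ)).to_subtype
  let P : Set (ℕ → ℕ) := {z | ∀ U ∈ b, z ∈ U → Cofinal U}
  have hPclosed : IsClosed P := by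
    rw [← isOpen_compl_iff, isOpen_iff_forall_mem_open]
    intro z hz
    simp only [P, mem_compl_iff, mem_ofPred_eq, not_forall] at hz
    obtain ⟨U, hU, hzU, hnot⟩ := hz
    exact ⟨U, fun y hy hyP => hnot (hyP U hU hy), hb.isOpen hU, hzU⟩
  -- A single member of the ideal witnesses that all basic sets which are not cofinal are so.
  obtain ⟨W, hW, hWnot⟩ : ∃ W ∈ 𝒥, ∀ U ∈ b, ¬ Cofinal U → ∀ z ∈ U, ¬ (W \ g z).Finite := by
    have hex : ∀ U : b, ∃ X ∈ 𝒥, ¬ Cofinal U → ∀ z ∈ (U : Set (ℕ → ℕ)), ¬ (X \ g z).Finite := by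
      intro U
      by_cases hU : Cofinal U
      · exact ⟨∅, hI.finite_mem ∅ finite_empty, fun hn => (hn hU).elim⟩
      · have := hU
        simp only [Cofinal, not_forall, not_exists, not_and] at this
        obtain ⟨X, hX, hz⟩ := this
        exact ⟨X, hX, fun _ => hz⟩
    choose X hX hXnot using hex
    have : Nonempty b := by
      obtain ⟨U, hU, -⟩ := hb.exists_subset_of_mem_open (mem_univ (0 : ℕ → ℕ)) isOpen_univ
      exact ⟨⟨U, hU⟩⟩
    obtain ⟨W, hW, hfin⟩ := h.isPIdeal.exists_pseudounion X hX
    refine ⟨W, hW, fun U hU hnot z hz hWz => hXnot ⟨U, hU⟩ hnot z hz ?_⟩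
    refine ((hfin ⟨U, hU⟩).union hWz).subset fun n hn => ?_
    by_cases hnW : n ∈ W
    · exact Or.inr ⟨hnW, hn.2⟩
    · exact Or.inl ⟨hn.1, hnW⟩
  have hcof : ∀ V, Cofinal V → ∀ X ∈ 𝒥, ∃ z ∈ P ∩ V, (X \ g z).Finite := by
    intro V hV X hX
    obtain ⟨z, hzV, hz⟩ := hV (X ∪ W) (hI.union_mem hX hW)
    refine ⟨z, ⟨fun U hU hzU => ?_, hzV⟩, hz.subset (sdiff_subset_sdiff_left subset_union_left)⟩
    by_contra hnot
    exact hWnot U hU hnot z hzU (hz.subset (sdiff_subset_sdiff_left subset_union_right))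
  obtain ⟨y₀, hy₀⟩ : P.Nonempty := by
    obtain ⟨z, hz, -⟩ := hcof univ (fun X hX => by
      obtain ⟨z, rfl⟩ := hsurj X hX
      exact ⟨z, mem_univ z, by simp⟩) ∅ (hI.finite_mem ∅ finite_empty)
    exact ⟨z, hz.1⟩
  refine ⟨{U : b // (P ∩ U).Nonempty}, inferInstance,
    fun U => {a | ∃ z ∈ P ∩ U, (a : Set ℕ) ⊆ g z}, fun X => ⟨fun hX => ?_, fun hX => ?_⟩⟩
  · rintro ⟨⟨U, hU⟩, y, hyP, hyU⟩
    obtain ⟨z, hz, hfin⟩ := hcof U (hyP U hU hyU) X hX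
    obtain ⟨m, hm⟩ := hfin.bddAbove
    refine ⟨m + 1, fun a ha => ⟨z, hz, fun n hn => ?_⟩⟩
    by_contra hnz
    have := hm ⟨(ha hn).1, hnz⟩
    exact (ha hn).2 (Nat.lt_succ_of_le this)
  · have hm : ∀ s : P × ℕ, ∃ m, s.2 ≤ m ∧ ∀ a : Finset ℕ, (a : Set ℕ) ⊆ X \ Iio m →
        ∃ z ∈ P ∩ PiNat.cylinder (s.1 : ℕ → ℕ) s.2, (a : Set ℕ) ⊆ g z := by
      rintro ⟨⟨y, hy⟩, n⟩
      obtain ⟨U, hU, hyU, hUn⟩ := hb.exists_subset_of_mem_open (PiNat.self_mem_cylinder y n)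
        (PiNat.isOpen_cylinder (fun _ : ℕ => ℕ) y n)
      obtain ⟨m, hm⟩ := hX ⟨⟨U, hU⟩, y, hy, hyU⟩
      refine ⟨max m n, le_max_right _ _, fun a ha => ?_⟩
      obtain ⟨z, hz, haz⟩ := hm a fun k hk =>
        ⟨(ha hk).1, fun hkm => (ha hk).2 (lt_of_lt_of_le hkm (le_max_left m n))⟩
      exact ⟨z, ⟨hz.1, hUn hz.2⟩, haz⟩
    choose m hm_ge hm using hm
    have hnext : ∀ (s : P × ℕ) (c : ℕ), ∃ t : P × ℕ, s.2 < t.2 ∧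
        (t.1 : ℕ → ℕ) ∈ PiNat.cylinder (s.1 : ℕ → ℕ) s.2 ∧
        ∀ z ∈ PiNat.cylinder (t.1 : ℕ → ℕ) t.2, ∀ j ∈ X, m s ≤ j → j < c → j ∈ g z := by
      intro s c
      obtain ⟨z, ⟨hzP, hzs⟩, hz⟩ := hm s ((Finset.Ico (m s) c).filter (· ∈ X)) (by
        intro j hj
        simp only [Finset.coe_filter, Finset.mem_Ico, mem_ofPred_eq] at hj
        exact ⟨hj.2, not_lt.mpr hj.1.1⟩)
      obtain ⟨n, hn⟩ := exists_cylinder_subset (hcont _) hz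
      refine ⟨⟨⟨z, hzP⟩, max n (s.2 + 1)⟩,
        Nat.lt_of_lt_of_le (Nat.lt_succ_self _) (le_max_right _ _), hzs, fun z' hz' j hjX hj hjc => ?_⟩
      refine hn (PiNat.cylinder_anti z (le_max_left _ _) hz') ?_
      simp [hjX, hj, hjc]
    choose next hnext_lt hnext_mem hnext using hnext
    -- Two converging sequences are interleaved: `u (i + 2)` extends `u i` and covers the part of
    -- `X` from the threshold of `u i` up to that of `u (i + 1)`.
    let w : ℕ → (P × ℕ) × (P × ℕ) := fun i => Nat.rec ((⟨y₀, hy₀⟩, 0), (⟨y₀, hy₀⟩, 0))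
      (fun _ p => (p.2, next p.1 (m p.2))) i
    let u : ℕ → P × ℕ := fun i => (w i).1
    have hu : ∀ i, u (i + 2) = next (u i) (m (u (i + 1))) := fun _ => rfl
    have hlim : ∀ r : ℕ, ∃ z, ∀ k, z ∈ PiNat.cylinder ((u (2 * k + r)).1 : ℕ → ℕ)
        (u (2 * k + r)).2 := by
      intro r
      have hsucc : ∀ k, u (2 * (k + 1) + r) = next (u (2 * k + r)) (m (u (2 * k + r + 1))) := by
        intro k
        rw [← hu, mul_add, mul_one, add_right_comm]
      obtain ⟨z, -, hz⟩ := exists_mem_forall_mem_cylinder hPclosed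
        (y := fun k => ((u (2 * k + r)).1 : ℕ → ℕ)) (fun k => (u (2 * k + r)).1.2)
        (n := fun k => (u (2 * k + r)).2)
        (strictMono_nat_of_lt_succ fun k => by
          rw [hsucc]
          exact hnext_lt _ _)
        (fun k => by
          rw [hsucc]
          exact hnext_mem _ _)
      exact ⟨z, hz⟩
    obtain ⟨α, hα⟩ := hlim 0
    obtain ⟨β, hβ⟩ := hlim 1
    have hlarge : ∀ k, k ≤ (u (2 * k)).2 := by
      intro k
      induction k with
      | zero => exact Nat.zero_le _
      | succ k ih =>
        have : (u (2 * k)).2 < (u (2 * (k + 1))).2 := hnext_lt (u (2 * k)) (m (u (2 * k + 1)))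
        omega
    refine hI.mem_of_subset (hI.union_mem (hI.finite_mem (Iio (m (u 0))) (finite_Iio _))
      (hI.union_mem (hg𝒥 α) (hg𝒥 β))) fun j hj => ?_
    by_cases hj0 : j < m (u 0)
    · exact Or.inl hj0
    right
    have hex : ∃ i, j < m (u i) :=
      ⟨2 * (j + 1), (Nat.lt_succ_self j).trans_le ((hlarge (j + 1)).trans (hm_ge _))⟩
    obtain ⟨i, hi⟩ : ∃ i, Nat.find hex = i + 1 := by
      refine Nat.exists_eq_succ_of_ne_zero fun h0 => hj0 ?_
      have := Nat.find_spec hex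
      rwa [h0] at this
    have hlt : j < m (u (i + 1)) := hi ▸ Nat.find_spec hex
    have hle : m (u i) ≤ j := not_lt.mp (Nat.find_min hex (by omega))
    have hcover : ∀ z ∈ PiNat.cylinder ((u (i + 2)).1 : ℕ → ℕ) (u (i + 2)).2, j ∈ g z :=
      fun z hz => hnext (u i) (m (u (i + 1))) z hz j hj hle hlt
    rcases Nat.even_or_odd' i with ⟨k, rfl | rfl⟩
    · exact Or.inl (hcover α (hα (k + 1)))
    · exact Or.inr (hcover β (hβ (k + 1)))

/-! ### Goodness and the antichain number -/

theorem IsAnalyticPIdeal.isGood {𝒥 : Set (Set ℕ)} (h : IsAnalyticPIdeal 𝒥) : IsGood 𝒥 := by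
  obtain ⟨ι, _, K, hK⟩ := h.exists_finset_families
  intro ℱ hℱ hunc
  -- One index `i` refutes membership in the ideal for uncountably many members of `ℱ`.
  obtain ⟨i, hi⟩ : ∃ i, ¬ {B ∈ ℱ | ∀ m, ∃ a : Finset ℕ, (a : Set ℕ) ⊆ B \ Iio m ∧
      a ∉ K i}.Countable := by
    by_contra! hcount
    refine hunc ((countable_iUnion hcount).mono fun B hB => ?_)
    have hpos : B ∉ 𝒥 := hℱ hB
    rw [hK] at hpos
    push Not at hpos
    obtain ⟨i, hi⟩ := hpos
    exact mem_iUnion.mpr ⟨i, hB, hi⟩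
  have hinf := fun hfin : Set.Finite _ => hi hfin.countable
  let B := Set.Infinite.natEmbedding _ hinf
  refine ⟨fun n => B n, fun n k hnk => B.injective (Subtype.ext hnk), fun n => (B n).2.1,
    fun f => ?_⟩
  choose a ha haK using fun n => (B n).2.2 (max n (f n))
  refine ⟨fun n => a n, fun n => h.isIdealOn.finite_mem _ (a n).finite_toSet,
    fun n j hj => ⟨(ha n hj).1, fun hjf => (ha n hj).2 (mem_Iio.mpr (lt_max_of_lt_right hjf))⟩,
    fun hmem => ?_⟩
  obtain ⟨m, hm⟩ := (hK _).mp hmem i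
  exact haK m (hm (a m) fun j hj => ⟨mem_iUnion.mpr ⟨m, hj⟩,
    fun hjm => (ha m hj).2 (mem_Iio.mpr (lt_max_of_lt_left hjm))⟩)

/-- The members of an uncountable antichain of size less than `𝔟` all have small intersection
with one positive set: the union of pieces of countably many members `B n`, the `n`-th of which
starts above a function that dominates, for each member `A`, the points after which the sets
`A ∩ B n` are contained in their pseudo-union. -/
theorem IsGood.bounding_le_mk {𝒥 : Set (Set ℕ)} (hI : IsIdealOn 𝒥) (hP : IsPIdeal 𝒥)
    (hgood : IsGood 𝒥) {𝒜 : Set (Set ℕ)} (hmax : Maximal (IsAntichainMod 𝒥) 𝒜)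
    (hunc : ¬ 𝒜.Countable) : bounding ≤ #𝒜 := by
  obtain ⟨B, hBinj, hB𝒜, hB⟩ := hgood 𝒜 hmax.prop.1 hunc
  have hg : ∀ A ∈ 𝒜, ∃ D ∈ 𝒥, ∃ g : ℕ → ℕ, ∀ n, B n ≠ A → (A ∩ B n) \ Iio (g n) ⊆ D := by
    intro A hA
    obtain ⟨D, hD, hfin⟩ := hP (fun n => {j ∈ A ∩ B n | B n ≠ A}) fun n => by
      by_cases h : B n = A
      · simpa [h] using hI.finite_mem ∅ finite_empty
      · exact hI.mem_of_subset (hmax.prop.2 hA (hB𝒜 n) (Ne.symm h)) fun j hj => hj.1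
    choose g hg using fun n => (hfin n).bddAbove
    refine ⟨D, hD, fun n => g n + 1, fun n hn j hj => ?_⟩
    by_contra hjD
    exact hj.2 (Nat.lt_succ_of_le (hg n ⟨⟨hj.1, hn⟩, hjD⟩))
  choose! D hD g hg using hg
  have hunbdd : ¬ ∃ G : ℕ → ℕ, ∀ f ∈ g '' 𝒜, f ≤ᶠ[atTop] G := by
    rintro ⟨G, hG⟩
    obtain ⟨C, hC𝒥, hCB, hCpos⟩ := hB G
    have hsmall : ∀ A ∈ 𝒜, (⋃ n, C n) ∩ A ∈ 𝒥 := by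
      intro A hA
      obtain ⟨N, hN⟩ := eventually_atTop.mp (hG (g A) (mem_image_of_mem g hA))
      -- Besides the initial `C n`, the piece of `A` itself is exceptional if `A` is one of the
      -- sets `B n`.
      obtain ⟨M, hM⟩ : ∃ M, ∀ n, B n = A → n < M := by
        by_cases h : ∃ n, B n = A
        · obtain ⟨n, hn⟩ := h
          exact ⟨n + 1, fun k hk => by rw [hBinj (hk.trans hn.symm)]; exact Nat.lt_succ_self n⟩
        · exact ⟨0, fun n hn => (h ⟨n, hn⟩).elim⟩
      refine hI.mem_of_subset (hI.union_mem (hI.biUnion_lt_mem hC𝒥 (max N M)) (hD A hA)) ?_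
      rintro j ⟨hjC, hjA⟩
      obtain ⟨n, hn⟩ := mem_iUnion.mp hjC
      by_cases hlt : n < max N M
      · exact Or.inl (mem_iUnion₂.mpr ⟨n, hlt, hn⟩)
      · rw [not_lt, max_le_iff] at hlt
        refine Or.inr (hg A hA n (fun h => (hM n h).not_ge hlt.2) ⟨⟨hjA, (hCB n hn).1⟩, ?_⟩)
        exact fun hj => (hCB n hn).2 (lt_of_lt_of_le hj (hN n hlt.1))
    have hins : IsAntichainMod 𝒥 (insert (⋃ n, C n) 𝒜) := by
      refine ⟨insert_subset hCpos hmax.prop.1, pairwise_insert.mpr ⟨hmax.prop.2, fun A hA _ => ?_⟩⟩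
      exact ⟨hsmall A hA, by rw [inter_comm]; exact hsmall A hA⟩
    have hmem : (⋃ n, C n) ∈ 𝒜 := hmax.le_of_ge hins (subset_insert _ _) (mem_insert _ _)
    have := hsmall _ hmem
    rw [inter_self] at this
    exact hCpos this
  have hle : bounding ≤ #(g '' 𝒜) := csInf_le' ⟨g '' 𝒜, hunbdd, rfl⟩
  exact hle.trans Cardinal.mk_image_le

theorem IsAnalyticPIdeal.bounding_le_antichainNumber {𝒥 : Set (Set ℕ)}
    (h : IsAnalyticPIdeal 𝒥) :
    (bounding : WithTop Cardinal.{0}) ≤ antichainNumber 𝒥 :=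
  le_iInf₂ fun _ h𝒜 => WithTop.coe_le_coe.mpr
    (h.isGood.bounding_le_mk h.isIdealOn h.isPIdeal h𝒜.1 h𝒜.2)

/-- Instance search finds both parent classes, but not `PolishSpace` itself. -/
instance : PolishSpace (ℕ → Bool) where

/-! ### The density zero ideal -/

theorem mem_densityZero_iff {A : Set ℕ} : A ∈ densityZero ↔
    Tendsto (fun n : ℕ => ((A ∩ Iio n).ncard : ℝ) / (n : ℝ)) atTop (𝓝 0) :=
  Iff.rfl

theorem densityZero_mono {A B : Set ℕ} (hAB : A ⊆ B) (hB : B ∈ densityZero) :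
    A ∈ densityZero := by
  refine squeeze_zero (fun n => by positivity) (fun n => ?_) hB
  gcongr
  exact (finite_Iio n).inter_of_right B

theorem isIdealOn_densityZero : IsIdealOn densityZero := by
  refine IsIdealOn.of_union_mem (fun _ _ => densityZero_mono) (fun A B hA hB => ?_)
    (fun A hA => ?_) fun h => ?_
  · have hsum := (mem_densityZero_iff.mp hA).add (mem_densityZero_iff.mp hB)
    rw [add_zero] at hsum
    refine squeeze_zero (fun n => by positivity) (fun n => ?_) hsum
    rw [← add_div, union_inter_distrib_right]
    gcongr
    exact_mod_cast ncard_union_le (A ∩ Iio n) (B ∩ Iio n)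
  · refine squeeze_zero (fun n => by positivity) (fun n => ?_)
      (tendsto_const_div_atTop_nhds_zero_nat (A.ncard : ℝ))
    gcongr
    exact inter_subset_left
  · have hone : Tendsto (fun n : ℕ => (((univ : Set ℕ) ∩ Iio n).ncard : ℝ) / (n : ℝ)) atTop
        (𝓝 1) := by
      refine tendsto_const_nhds.congr' ?_
      filter_upwards [eventually_gt_atTop 0] with n hn
      have : (n : ℝ) ≠ 0 := by positivity
      rw [univ_inter, ← Finset.coe_Iio, ncard_coe_finset, Nat.card_Iio, div_self this]
    exact zero_ne_one (tendsto_nhds_unique h hone)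

theorem isAnalyticFamily_densityZero : IsAnalyticFamily densityZero := by
  have hcard : ∀ (x : ℕ → Bool) (n : ℕ), (({k | x k = true} ∩ Iio n).ncard : ℝ) =
      ∑ k ∈ Finset.range n, if x k = true then (1 : ℝ) else 0 := by
    intro x n
    have : {k | x k = true} ∩ Iio n = ((Finset.range n).filter fun k => x k = true : Finset ℕ) := by
      ext k
      simp [and_comm]
    rw [this, ncard_coe_finset, Finset.sum_boole]
  refine MeasurableSet.analyticSet (measurableSet_tendsto (𝓝 0) fun n => ?_)
  simp only [hcard]
  refine (Finset.measurable_sum _ fun k _ => ?_).div_const _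
  exact (measurable_of_finite fun c : Bool => if c = true then (1 : ℝ) else 0).comp
    (measurable_pi_apply k)

theorem isPIdeal_densityZero : IsPIdeal densityZero := by
  intro A hA
  let A' : ℕ → Set ℕ := fun N => ⋃ n < N, A n
  have hA' : ∀ N, A' N ∈ densityZero := isIdealOn_densityZero.biUnion_lt_mem hA
  have hk : ∀ N : ℕ, ∃ k, ∀ n ≥ k, ((A' (N + 1) ∩ Iio n).ncard : ℝ) / n < 1 / ((N : ℝ) + 1) :=
    fun N => eventually_atTop.mp ((hA' (N + 1)).eventually_lt_const (by positivity))
  choose k hk using hk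
  -- A strictly increasing sequence of thresholds: from `K N` on, the density of `A' (N + 1)` is
  -- less than `1 / (N + 1)`.
  let K : ℕ → ℕ := fun N => (Finset.range (N + 1)).sup k + N
  have hK : StrictMono K := by
    refine strictMono_nat_of_lt_succ fun N => ?_
    have : (Finset.range (N + 1)).sup k ≤ (Finset.range (N + 1 + 1)).sup k :=
      Finset.sup_mono (Finset.range_mono (Nat.le_succ _))
    simp only [K]
    omega
  have hkK : ∀ N, k N ≤ K N := fun N =>
    (Finset.le_sup (f := k) (Finset.self_mem_range_succ N)).trans (Nat.le_add_right _ _)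
  refine ⟨⋃ n, A n \ Iio (K n), ?_, fun n => (finite_Iio (K n)).subset fun j hj => ?_⟩
  · rw [mem_densityZero_iff, Metric.tendsto_atTop]
    intro ε hε
    obtain ⟨N₀, hN₀⟩ := exists_nat_one_div_lt hε
    refine ⟨K N₀, fun n hn => ?_⟩
    rw [Real.dist_0_eq_abs, abs_of_nonneg (by positivity)]
    obtain ⟨N, hN, hnN⟩ : ∃ N, K N ≤ n ∧ n < K (N + 1) := by
      have hex : ∃ N, n < K N := ⟨n + 1, (Nat.lt_succ_self n).trans_le hK.le_apply⟩
      obtain ⟨N, hN⟩ := Nat.exists_eq_succ_of_ne_zero (n := Nat.find hex) fun h0 => by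
        have := Nat.find_spec hex
        rw [h0] at this
        exact absurd (hK.monotone (Nat.zero_le N₀)) (by omega)
      have hspec := Nat.find_spec hex
      rw [hN] at hspec
      exact ⟨N, not_lt.mp (Nat.find_min hex (by omega)), hspec⟩
    have hNN : N₀ ≤ N := by
      by_contra! hlt
      exact absurd (hK.monotone (Nat.succ_le_of_lt hlt)) (by simp only [Nat.succ_eq_add_one]; omega)
    calc (((⋃ n, A n \ Iio (K n)) ∩ Iio n).ncard : ℝ) / n
        ≤ ((A' (N + 1) ∩ Iio n).ncard : ℝ) / n := by
          gcongr ?_ / _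
          refine Nat.cast_le.mpr (ncard_le_ncard ?_ ((finite_Iio n).inter_of_right _))
          rintro j ⟨hj, hjn⟩
          refine ⟨?_, hjn⟩
          obtain ⟨i, hjA, hjK⟩ := mem_iUnion.mp hj
          refine mem_iUnion₂.mpr ⟨i, ?_, hjA⟩
          have hjK : K i ≤ j := not_lt.mp hjK
          have hjn : j < n := hjn
          exact hK.lt_iff_lt.mp (by omega)
      _ < 1 / ((N : ℝ) + 1) := hk N n ((hkK N).trans hN)
      _ ≤ 1 / ((N₀ : ℝ) + 1) := by gcongr
      _ < ε := hN₀
  · by_contra hjK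
    exact hj.2 (mem_iUnion.mpr ⟨n, hj.1, hjK⟩)

theorem isAnalyticPIdeal_densityZero : IsAnalyticPIdeal densityZero :=
  ⟨isIdealOn_densityZero, isAnalyticFamily_densityZero, isPIdeal_densityZero⟩

/-! ### The trace of the null ideal -/

instance : IsProbabilityMeasure cantorMeasure := by
  unfold cantorMeasure
  infer_instance

/-- The initial segment of length `n` of a point of the Cantor space. -/
def initialSegment (n : ℕ) (x : ℕ → Bool) : List Bool :=
  List.ofFn fun i : Fin n => x i

theorem length_initialSegment (n : ℕ) (x : ℕ → Bool) : (initialSegment n x).length = n :=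
  List.length_ofFn

theorem mem_limitSet {A : Set (List Bool)} {x : ℕ → Bool} :
    x ∈ limitSet A ↔ ∃ᶠ n : ℕ in atTop, initialSegment n x ∈ A :=
  Iff.rfl

theorem measurableSet_initialSegment_eq (n : ℕ) (l : List Bool) :
    MeasurableSet {x | initialSegment n x = l} := by
  have h : Measurable fun x : ℕ → Bool => fun i : Fin n => x i :=
    measurable_pi_lambda _ fun i => measurable_pi_apply _
  exact h (MeasurableSet.of_discrete (s := {v : Fin n → Bool | List.ofFn v = l}))

theorem measurableSet_initialSegment_mem (n : ℕ) (A : Set (List Bool)) :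
    MeasurableSet {x | initialSegment n x ∈ A} := by
  have : {x | initialSegment n x ∈ A} = ⋃ l ∈ A, {x | initialSegment n x = l} := by
    ext x
    simp
  rw [this]
  exact MeasurableSet.biUnion (to_countable A) fun l _ => measurableSet_initialSegment_eq n l

theorem limitSet_mono {A B : Set (List Bool)} (h : A ⊆ B) : limitSet A ⊆ limitSet B :=
  fun _ hx => hx.mono fun _ hn => h hn

theorem limitSet_union (A B : Set (List Bool)) : limitSet (A ∪ B) = limitSet A ∪ limitSet B := by
  ext x
  simp only [mem_limitSet, mem_union, frequently_or_distrib]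

theorem isIdealOn_traceNull : IsIdealOn traceNull := by
  refine IsIdealOn.of_union_mem (fun A B hAB hB => measure_mono_null (limitSet_mono hAB) hB)
    (fun A B hA hB => ?_) (fun A hA => ?_) fun h => ?_
  · have : cantorMeasure (limitSet A ∪ limitSet B) = 0 := measure_union_null hA hB
    rwa [← limitSet_union] at this
  · have : limitSet A = ∅ := by
      refine eq_empty_of_forall_notMem fun x hx => ?_
      obtain ⟨N, hN⟩ := (hA.image List.length).bddAbove
      obtain ⟨n, hn, hxn⟩ := frequently_atTop.mp (mem_limitSet.mp hx) (N + 1)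
      have : n ≤ N := length_initialSegment n x ▸ hN (mem_image_of_mem _ hxn)
      omega
    change cantorMeasure (limitSet A) = 0
    rw [this, measure_empty]
  · have huniv : limitSet univ = univ := eq_univ_of_forall fun x =>
      mem_limitSet.mpr (Frequently.of_forall fun n => mem_univ _)
    have h : cantorMeasure (limitSet univ) = 0 := h
    rw [huniv, measure_univ] at h
    exact one_ne_zero h

/-- The measure of the set of points with an initial segment in `A ∈ tr(𝒩)` of length at least
`k` tends to zero. -/
theorem exists_measure_initialSegment_mem_lt {A : Set (List Bool)} (hA : A ∈ traceNull)
    {ε : ENNReal} (hε : 0 < ε) :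
    ∃ k, cantorMeasure {x | ∃ n ≥ k, initialSegment n x ∈ A} < ε := by
  have hlim := tendsto_measure_iInter_atTop (μ := cantorMeasure)
    (s := fun k => {x | ∃ n ≥ k, initialSegment n x ∈ A})
    (fun k => MeasurableSet.nullMeasurableSet <| by
      have : {x | ∃ n ≥ k, initialSegment n x ∈ A} =
          ⋃ n, ⋃ (_ : n ≥ k), {x | initialSegment n x ∈ A} := by
        ext x
        simp
      rw [this]
      exact MeasurableSet.iUnion fun n => MeasurableSet.iUnion fun _ =>
        measurableSet_initialSegment_mem n A)
    (fun k l hkl x => fun ⟨n, hn, hx⟩ => ⟨n, hkl.trans hn, hx⟩)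
    ⟨0, measure_ne_top _ _⟩
  have hset : (⋂ k, {x | ∃ n ≥ k, initialSegment n x ∈ A}) = limitSet A := by
    ext x
    simp only [mem_iInter, mem_ofPred_eq, mem_limitSet, frequently_atTop]
  have hA : cantorMeasure (limitSet A) = 0 := hA
  rw [hset, hA] at hlim
  exact (hlim.eventually_lt_const hε).exists

theorem isPIdeal_traceNull : IsPIdeal traceNull := by
  intro A hA
  obtain ⟨ε, hε, hsum⟩ := ENNReal.exists_pos_sum_of_countable' one_ne_zero ℕ
  choose k hk using fun n => exists_measure_initialSegment_mem_lt (hA n) (hε n)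
  refine ⟨⋃ n, {l ∈ A n | k n ≤ l.length}, ?_, fun n => ?_⟩
  · -- By the Borel–Cantelli lemma, almost every point has only finitely many `n` for which some
    -- initial segment of length at least `k n` is in `A n`.
    have hBC : ∀ᵐ x ∂cantorMeasure,
        ∀ᶠ n in atTop, x ∉ {x | ∃ j ≥ k n, initialSegment j x ∈ A n} :=
      ae_eventually_notMem ((ENNReal.tsum_le_tsum fun n => (hk n).le).trans_lt
        (hsum.trans ENNReal.one_lt_top)).ne
    have hnull : ∀ᵐ x ∂cantorMeasure, ∀ n, x ∉ limitSet (A n) :=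
      ae_all_iff.mpr fun n => measure_eq_zero_iff_ae_notMem.mp (hA n)
    refine measure_eq_zero_iff_ae_notMem.mpr ?_
    filter_upwards [hBC, hnull] with x hx hx' hmem
    obtain ⟨N, hN⟩ := eventually_atTop.mp hx
    have hev : ∀ᶠ j in atTop, ∀ n ∈ Finset.range N, initialSegment j x ∉ A n :=
      (Finset.eventually_all _).mpr fun n _ => not_frequently.mp (hx' n)
    obtain ⟨j, hj, hjA⟩ := ((mem_limitSet.mp hmem).and_eventually hev).exists
    obtain ⟨n, hjn, hle⟩ := mem_iUnion.mp hj
    rw [length_initialSegment] at hle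
    by_cases hnN : n < N
    · exact hjA n (Finset.mem_range.mpr hnN) hjn
    · exact hN n (not_lt.mp hnN) ⟨j, hle, hjn⟩
  · refine (List.finite_length_lt Bool (k n)).subset fun l hl => ?_
    by_contra hlen
    exact hl.2 (mem_iUnion.mpr ⟨n, hl.1, not_lt.mp hlen⟩)

/-- Membership in a copy of `tr(𝒩)` is a Borel condition, by the measurability of the measure of
the sections of a Borel set. -/
theorem isAnalyticFamily_copy_traceNull (e : List Bool ≃ ℕ) :
    IsAnalyticFamily (copy e traceNull) := by
  let E : Set ((ℕ → Bool) × (ℕ → Bool)) :=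
    {p | ∃ᶠ n in atTop, p.1 (e (initialSegment n p.2)) = true}
  have hE : MeasurableSet E := by
    have : E = limsup (fun n => {p : (ℕ → Bool) × (ℕ → Bool) |
        p.1 (e (initialSegment n p.2)) = true}) atTop := by
      ext p
      simp only [E, mem_ofPred_eq, mem_limsup_iff_frequently_mem]
    rw [this]
    refine MeasurableSet.measurableSet_limsup fun n => ?_
    have : {p : (ℕ → Bool) × (ℕ → Bool) | p.1 (e (initialSegment n p.2)) = true} =
        ⋃ l, {x : ℕ → Bool | x (e l) = true} ×ˢ {x | initialSegment n x = l} := by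
      ext p
      simp
    rw [this]
    refine MeasurableSet.iUnion fun l => MeasurableSet.prod ?_ (measurableSet_initialSegment_eq n l)
    exact measurable_pi_apply (X := fun _ : ℕ => Bool) (e l) (measurableSet_singleton true)
  exact ((measurable_measure_prodMk_left (ν := cantorMeasure) hE)
    (measurableSet_singleton 0)).analyticSet

theorem IsIdealOn.copy {α : Type} {𝒥 : Set (Set α)} (h : IsIdealOn 𝒥) (e : α ≃ ℕ) :
    IsIdealOn (copy e 𝒥) :=
  IsIdealOn.of_union_mem (fun _ _ hAB hB => h.mem_of_subset hB (preimage_mono hAB))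
    (fun _ _ hA hB => h.union_mem hA hB)
    (fun _ hA => h.finite_mem _ (hA.preimage e.injective.injOn)) h.univ_notMem

theorem IsPIdeal.copy {α : Type} {𝒥 : Set (Set α)} (h : IsPIdeal 𝒥) (e : α ≃ ℕ) :
    IsPIdeal (copy e 𝒥) := by
  intro A hA
  obtain ⟨B, hB, hfin⟩ := h (fun n => e ⁻¹' A n) hA
  refine ⟨e '' B, by simpa [AntichainNumbers.copy, e.injective.preimage_image] using hB,
    fun n => ?_⟩
  have := (hfin n).image e
  rwa [image_sdiff e.injective, image_preimage_eq _ e.surjective] at this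

theorem isAnalyticPIdeal_copy_traceNull (e : List Bool ≃ ℕ) :
    IsAnalyticPIdeal (copy e traceNull) :=
  ⟨isIdealOn_traceNull.copy e, isAnalyticFamily_copy_traceNull e, isPIdeal_traceNull.copy e⟩

end AntichainNumbers

/-! ### Analytic `P`-ideals are good -/

theorem mainTheorem11 :
    (∀ 𝒥 : Set (Set ℕ), AntichainNumbers.IsAnalyticPIdeal 𝒥 →
      AntichainNumbers.IsGood 𝒥 ∧
        min (AntichainNumbers.bounding : WithTop Cardinal.{0}) (AntichainNumbers.covPlusH 𝒥) ≤
          AntichainNumbers.antichainNumber 𝒥) ∧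
    (AntichainNumbers.IsAnalyticPIdeal AntichainNumbers.densityZero ∧
      AntichainNumbers.IsGood AntichainNumbers.densityZero ∧
        min (AntichainNumbers.bounding : WithTop Cardinal.{0})
            (AntichainNumbers.covPlusH AntichainNumbers.densityZero) ≤
          AntichainNumbers.antichainNumber AntichainNumbers.densityZero) ∧
    (∀ e : List Bool ≃ ℕ,
      AntichainNumbers.IsAnalyticPIdeal
          (AntichainNumbers.copy e AntichainNumbers.traceNull) ∧
        AntichainNumbers.IsGood (AntichainNumbers.copy e AntichainNumbers.traceNull) ∧
          min (AntichainNumbers.bounding : WithTop Cardinal.{0})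
              (AntichainNumbers.covPlusH
                (AntichainNumbers.copy e AntichainNumbers.traceNull)) ≤
            AntichainNumbers.antichainNumber
              (AntichainNumbers.copy e AntichainNumbers.traceNull)) := by
  have key : ∀ 𝒥 : Set (Set ℕ), AntichainNumbers.IsAnalyticPIdeal 𝒥 →
      AntichainNumbers.IsGood 𝒥 ∧
        min (AntichainNumbers.bounding : WithTop Cardinal.{0}) (AntichainNumbers.covPlusH 𝒥) ≤
          AntichainNumbers.antichainNumber 𝒥 :=
    fun 𝒥 h => ⟨h.isGood, (min_le_left _ _).trans h.bounding_le_antichainNumber⟩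
  have hZ := AntichainNumbers.isAnalyticPIdeal_densityZero
  have hN := AntichainNumbers.isAnalyticPIdeal_copy_traceNull
  exact ⟨key, ⟨hZ, key _ hZ⟩, fun e => ⟨hN e, key _ (hN e)⟩⟩
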